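/- Setting. Let $T>0$ and let $X=(X_t)_{t\in[0,T]}$ be a continuous centered Gaussian process with $X_0=0$ and covariance $R(t,s)=\mathbb E[X_tX_s]$ that is a regular invertible Gaussian Volterra process. This means the following. (i) There are a continuous non-decreasing $m\colon[0,T]\to\mathbb R_+$ and a Volterra kernel $K$ (that is, $K(t,s)=0$ for $t<s$), with $K\in L^2([0,T]^2,dm\times dm)$ and $K(t,\cdot)\in L^2(dm)$ for every $t\in[0,T]$, such that $$R(t,s)=\int_0^{t\wedge s}K(t,v)K(s,v)\,dm(v),\qquad s,t\in[0,T].$$ For every $s\in(0,T]$ the map $t\mapsto K(t,s)$ is non-decreasing on $[0,T]$; the derivative $\frac{\partial K}{\partial t}(t,s)$ exists and is jointly continuous on $\{0<s<t\le T\}$; and $s\mapsto K(s,s)$ is continuously differentiable on $(0,T]$. (ii) Put $$\mathrm K^*[g](s)=g(s)K(T,s)+\int_s^T[g(r)-g(s)]\frac{\partial K}{\partial r}(r,s)\,dr .$$ For step functions $g,h$ (linear combinations of the $1_{[0,r)}$, $r \in [0,T]$, with $\int 1_{[0,r)}\,dX=X_r$) one has $\mathbb E[\int g\,dX\int h\,dX]=\int_0^T\mathrm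 K^*[g]\,\mathrm K^*[h]\,dm$. Both $\mathrm K^*$, with values in $L^2(dm)$, and the Wiener integral $\int\cdot\,dX$, with values in $L^2(\mathbb P)$, are extended by continuity to the closure (completion) of the step functions under this isometry. For each $t\in[0,T]$ the equation $\mathrm K^*[g]=1_{[0,t)}$ has a solution $g$ in the closure of the step functions on $[0,t)$. Let $\mu\colon[0,T]\to\mathbb R$ be continuous with bounded variation. Let $q^2(t)=\langle X\rangle_t$ be the (deterministic) quadratic variation of $X$, i.e. the limit in probability of $\sum_{t_k\le t}(X_{t_k}-X_{t_{k-1}})^2$ along partitions of $[0,T]$ with mesh tending to $0$. Put $\mu(u,t)=\mu(t)-\mu(u)$, $q^2(u,t)=q^2(t)-q^2(u)$ and $\beta(u,t)=\mu(u,t)-\frac12q^2(u,t)$. Let the asset price, with dynamics $dS_t/S_t=d\mu(t)+dX_t$, be $$S_t=S_0\exp\{\beta(0,t)+X_t\},\qquad t\in[0,T],$$ with a constant $S_0\neq0$. Write $\mathcal F_u^X=\sigma(X_s,s\le u)$ and $\mathcal F_u^S=\sigma(S_s,s\le u)$. For $0\le u\le t\le T$ let $$\hat\rho^2(t|u)=R(t,t)-\int_0^uK(t,v)^2\,dm(v),\quad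 \hat\rho(t|u)\ge 0,\qquad \Psi(t,\cdot|u)=(\mathrm K^*)^{-1}\big[1_{[0,u)}\,(K(u,\cdot)-K(t,\cdot))\big],$$ the inverse being taken in the closure of the step functions on $[0,u)$. Corollary 4.2 (Prediction). Let $0\le u\le t\le T$ and let $f\colon[0,T]\times\mathbb R\to\mathbb R$ be such that $f(t,\cdot)$ is Borel measurable and $f(t,S_t)$ is integrable. Let $\phi$ be the standard Gaussian density. Then $\hat\rho^2(t|u)$ is the conditional variance of $X_t$ given $\mathcal F_u^X$, the integrand $\Psi(t,\cdot|u)$ and its Wiener integral $\int_0^u\Psi(t,s|u)\,dX_s$ exist, and almost surely $$\mathbb E\big[f(t,S_t)\,\big|\,\mathcal F_u^S\big]=\int_{-\infty}^\infty f\Big(t,\;S_u\exp\Big\{\beta(u,t)-\int_0^u\Psi(t,s|u)\,dX_s+\hat\rho(t|u)z\Big\}\Big)\phi(z)\,dz ,$$ where the integral on the right-hand side is almost surely absolutely convergent. -/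

import Mathlib

open MeasureTheory ProbabilityTheory Filter Topology Set

namespace GaussVolterra

noncomputable section

/-! ### Volterra kernels and the operator `K*` -/

/-- The measure `dm` on `[0,T]`. (The increasing function `m` is continuous on `[0,T]`, so that
endpoints carry no mass.) -/
def dm (T : ℝ) (m : StieltjesFunction ℝ) : Measure ℝ := m.measure.restrict (Ioc 0 T)

/-- The partial derivative `∂K/∂t (t, s)` on `[0,T]` (one-sided at the end points of `[0,T]`). -/
def partialT (T : ℝ) (K : ℝ → ℝ → ℝ) (t s : ℝ) : ℝ :=
  derivWithin (fun r => K r s) (Icc 0 T) t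

/-- `K*[f](s) = f(s) K(T,s) + ∫_s^T [f(t) - f(s)] ∂K/∂t (t,s) dt`. -/
def kStar (T : ℝ) (K : ℝ → ℝ → ℝ) (f : ℝ → ℝ) (s : ℝ) : ℝ :=
  f s * K T s + ∫ t in s..T, (f t - f s) * partialT T K t s

/-- Regularity of the pair `(m, K)`: `m` is a continuous non-decreasing function (monotonicity is
part of `StieltjesFunction`) with values in `ℝ₊` on `[0,T]`, and `K` is a square integrable Volterra
kernel, non-decreasing in the first variable, continuously differentiable in the first variable
off the diagonal, and continuously differentiable along the diagonal. Kernels such as that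
of fractional Brownian motion are singular at `s = 0`, so regularity is only asked for `s > 0`. -/
structure IsRegularKernel (T : ℝ) (m : StieltjesFunction ℝ) (K : ℝ → ℝ → ℝ) : Prop where
  m_nonneg : ∀ t ∈ Icc 0 T, 0 ≤ m t
  m_continuousOn : ContinuousOn m (Icc 0 T)
  volterra : ∀ t ∈ Icc 0 T, ∀ s ∈ Icc 0 T, t < s → K t s = 0
  memLp : MemLp (fun p : ℝ × ℝ => K p.1 p.2) 2 ((dm T m).prod (dm T m))
  memLp_section : ∀ t ∈ Icc 0 T, MemLp (K t) 2 (dm T m)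
  monotoneOn : ∀ s ∈ Ioc 0 T, MonotoneOn (fun t => K t s) (Icc 0 T)
  differentiable : ∀ s t, 0 < s → s < t → t ≤ T →
    DifferentiableWithinAt ℝ (fun r => K r s) (Icc 0 T) t
  continuousOn_partialT : ContinuousOn (fun p : ℝ × ℝ => partialT T K p.1 p.2)
    {p : ℝ × ℝ | 0 < p.2 ∧ p.2 < p.1 ∧ p.1 ≤ T}
  diagonal : ContDiffOn ℝ 1 (fun s => K s s) (Ioc 0 T)

/-! ### Step functions, the closure of the step functions, and Wiener integrals

A finitely supported `c : ℝ →₀ ℝ` encodes the step function `∑_r c(r) 1_{[0,r)}`. -/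

/-- The step function `∑_r c(r) 1_{[0,r)}`. -/
def stepFun (c : ℝ →₀ ℝ) (s : ℝ) : ℝ :=
  c.sum fun r a => a * (Ico 0 r).indicator (fun _ => (1 : ℝ)) s

/-- The Wiener integral `∑_r c(r) X_r` of the step function `∑_r c(r) 1_{[0,r)}` (recall
`X_0 = 0`). -/
def stepIntegral {Ω : Type*} (X : ℝ → Ω → ℝ) (c : ℝ →₀ ℝ) (ω : Ω) : ℝ :=
  c.sum fun r a => a * X r ω

/-- `Φ = (K*)⁻¹[g]` as an element of the closure of the step functions on `[0,u)`.
The norm on step functions is `f ↦ ‖K*[f]‖_{L²(dm)}`, and an element of the closure (completion) is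
given by a sequence `Φ` of step functions that is Cauchy for this norm; `K*` extends isometrically
to the closure, its value at `Φ` being the `L²(dm)`-limit of `K*[Φ n]`. The predicate says
that this value is `g`. -/
structure IsKStarInverse (T : ℝ) (m : StieltjesFunction ℝ) (K : ℝ → ℝ → ℝ) (u : ℝ)
    (g : ℝ → ℝ) (Φ : ℕ → ℝ →₀ ℝ) : Prop where
  support : ∀ n, ∀ r ∈ (Φ n).support, r ∈ Icc 0 u
  tendsto : Tendsto
    (fun n => eLpNorm (fun s => kStar T K (stepFun (Φ n)) s - g s) 2 (dm T m)) atTop (𝓝 0)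

/-- `Z` is (a version of) the Wiener integral `∫ Φ dX` of the element `Φ` of the closure of the
step functions: the limit in `L²(P)` of the integrals of the approximating step functions. -/
structure IsWienerIntegral {Ω : Type*} [MeasurableSpace Ω] (P : Measure Ω) (X : ℝ → Ω → ℝ)
    (Φ : ℕ → ℝ →₀ ℝ) (Z : Ω → ℝ) : Prop where
  memLp : MemLp Z 2 P
  tendsto : Tendsto
    (fun n => eLpNorm (fun ω => stepIntegral X (Φ n) ω - Z ω) 2 P) atTop (𝓝 0)

/-! ### Regular invertible Gaussian Volterra processes -/

/-- The covariance function `R(t,s) = E[X_t X_s]` of a centered process. -/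
def cov {Ω : Type*} [MeasurableSpace Ω] (P : Measure Ω) (X : ℝ → Ω → ℝ) (t s : ℝ) : ℝ :=
  ∫ ω, X t ω * X s ω ∂P

/-- `X` is, on `[0,T]`, a continuous centered Gaussian process with `X_0 = 0` that is a regular
invertible Gaussian Volterra process with kernel `K` and function `m`. -/
structure IsRIGV {Ω : Type*} [MeasurableSpace Ω] (P : Measure Ω) (T : ℝ)
    (X : ℝ → Ω → ℝ) (m : StieltjesFunction ℝ) (K : ℝ → ℝ → ℝ) : Prop where
  measurable : ∀ t ∈ Icc 0 T, Measurable (X t)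
  gaussian : IsGaussianProcess (fun (t : Icc (0 : ℝ) T) => X t) P
  centered : ∀ t ∈ Icc 0 T, ∫ ω, X t ω ∂P = 0
  continuous : ∀ᵐ ω ∂P, ContinuousOn (fun t => X t ω) (Icc 0 T)
  zero : ∀ᵐ ω ∂P, X 0 ω = 0
  regular : IsRegularKernel T m K
  cov_eq : ∀ t ∈ Icc 0 T, ∀ s ∈ Icc 0 T,
    cov P X t s = ∫ v in Ioc 0 (min t s), K t v * K s v ∂m.measure
  /-- For each `t`, the equation `K*[f] = 1_{[0,t)}` has a solution `f = K⁻¹(t,·)` in the closure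
  of the step functions on `[0,t)`. -/
  invertible : ∀ t ∈ Icc 0 T, ∃ Φ : ℕ → ℝ →₀ ℝ,
    IsKStarInverse T m K t ((Ico 0 t).indicator fun _ => 1) Φ

/-! ### Quadratic variation and the price process -/

/-- `0 = p n 0 < p n 1 < ⋯ < p n (N n) = T` is a sequence of partitions of `[0,T]` with mesh
tending to `0`. -/
structure IsPartitionSeq (T : ℝ) (N : ℕ → ℕ) (p : ℕ → ℕ → ℝ) : Prop where
  first : ∀ n, p n 0 = 0
  last : ∀ n, p n (N n) = T
  lt : ∀ n, ∀ k < N n, p n k < p n (k + 1)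
  mesh : ∀ ε > 0, ∀ᶠ n in atTop, ∀ k < N n, p n (k + 1) - p n k < ε

/-- `∑_{t_k ≤ t} (X_{t_k} - X_{t_{k-1}})²` for the partition `t_0 < ⋯ < t_N`. -/
def quadSum {Ω : Type*} (X : ℝ → Ω → ℝ) (N : ℕ) (p : ℕ → ℝ) (t : ℝ) (ω : Ω) : ℝ :=
  ∑ k ∈ Finset.range N, if p (k + 1) ≤ t then (X (p (k + 1)) ω - X (p k) ω) ^ 2 else 0

/-- `X` has the deterministic quadratic variation `c` on `[0,t]`: along each sequence of
partitions of `[0,T]` with mesh tending to `0` the sums of squares converge to `c` in probability. -/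
def HasQuadVar {Ω : Type*} [MeasurableSpace Ω] (P : Measure Ω) (T : ℝ) (X : ℝ → Ω → ℝ)
    (t c : ℝ) : Prop :=
  ∀ N p, IsPartitionSeq T N p →
    TendstoInMeasure P (fun n => quadSum X (N n) (p n) t) atTop (fun _ => c)

open Classical in
/-- The quadratic variation function `q²(t) = ⟨X⟩_t`. -/
def quadVar {Ω : Type*} [MeasurableSpace Ω] (P : Measure Ω) (T : ℝ) (X : ℝ → Ω → ℝ)
    (t : ℝ) : ℝ :=
  if h : ∃ c, HasQuadVar P T X t c then h.choose else 0

/-- `β(u,t) = μ(u,t) - ½ q²(u,t)`, where `μ(u,t) = μ(t) - μ(u)` and `q²(u,t) = q²(t) - q²(u)`. -/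
def beta {Ω : Type*} [MeasurableSpace Ω] (P : Measure Ω) (T : ℝ) (X : ℝ → Ω → ℝ)
    (μ : ℝ → ℝ) (u t : ℝ) : ℝ :=
  (μ t - μ u) - (quadVar P T X t - quadVar P T X u) / 2

/-- The price process `S_t = S₀ exp{μ(0,t) - ½ q²(0,t) + X_t}` with dynamics
`dS_t / S_t = dμ(t) + dX_t`. -/
def price {Ω : Type*} [MeasurableSpace Ω] (P : Measure Ω) (T : ℝ) (X : ℝ → Ω → ℝ)
    (μ : ℝ → ℝ) (S₀ : ℝ) (t : ℝ) (ω : Ω) : ℝ :=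
  S₀ * Real.exp (beta P T X μ 0 t + X t ω)

/-! ### Prediction -/

/-- `F_u^Y = σ(Y_s, 0 ≤ s ≤ u)`. -/
@[reducible] def past {Ω : Type*} (Y : ℝ → Ω → ℝ) (u : ℝ) : MeasurableSpace Ω :=
  ⨆ s ∈ Icc 0 u, MeasurableSpace.comap (Y s) inferInstance

/-- `ρ̂(t|u)`, the square root of `R(t,t) - ∫_0^u K(t,v)² dm(v)`. -/
def rhoHat {Ω : Type*} [MeasurableSpace Ω] (P : Measure Ω) (X : ℝ → Ω → ℝ)
    (m : StieltjesFunction ℝ) (K : ℝ → ℝ → ℝ) (t u : ℝ) : ℝ :=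
  Real.sqrt (cov P X t t - ∫ v in Ioc 0 u, K t v * K t v ∂m.measure)

/-- `Ψ = Ψ(t,·|u) = (K*)⁻¹[1_{[0,u)} (K(u,·) - K(t,·))]`. -/
def IsPsi (T : ℝ) (m : StieltjesFunction ℝ) (K : ℝ → ℝ → ℝ) (t u : ℝ)
    (Ψ : ℕ → ℝ →₀ ℝ) : Prop :=
  IsKStarInverse T m K u ((Ico 0 u).indicator fun s => K u s - K t s) Ψ

/-- The integrand
`z ↦ f(t, S_u exp{β(u,t) - Z + ρ̂(t|u) z}) φ(z)`, with `φ` the standard Gaussian density and `Z`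
standing for `∫_0^u Ψ(t,s|u) dX_s`. -/
def predictionIntegrand {Ω : Type*} [MeasurableSpace Ω] (P : Measure Ω) (T : ℝ)
    (X : ℝ → Ω → ℝ) (m : StieltjesFunction ℝ) (K : ℝ → ℝ → ℝ) (μ : ℝ → ℝ) (S₀ : ℝ)
    (f : ℝ → ℝ → ℝ) (u t : ℝ) (Z : Ω → ℝ) (ω : Ω) (z : ℝ) : ℝ :=
  f t (price P T X μ S₀ u ω * Real.exp (beta P T X μ u t - Z ω + rhoHat P X m K t u * z))
    * gaussianPDFReal 0 1 z

end

end GaussVolterra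

/-!
The covariance formula makes `X_r ↦ K(r,·)` an isometry from the Gaussian space spanned by `X` into
`L²(dm)` (`IsRIGV.inner_truncLp`), and a direct computation gives `K* 1_{[0,r)} = K(r,·)`
(`IsRegularKernel.kStar_stepFun`). So Wiener integrals exist as soon as the integrand does, and the
equation `K* Φ = G` on `[0,u)` is solvable iff `G` lies in the closed span of the `K(r,·)`, `r ≤ u`.
By invertibility this closed span contains all `1_{[0,r)}`, `r ≤ u`, hence every square integrable
function carried by `[0,u)` (`IsRegularKernel.exists_isKStarInverse`); in particular `Ψ(t,·|u)`
exists.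

The innovation `Y = X_t - X_u + ∫ Ψ dX` corresponds under the isometry to
`K(t,·) - K(u,·) + 1_{[0,u)} (K(u,·) - K(t,·)) = 1_{(u,T]} K(t,·)`. It is orthogonal to `X_s` for
`s ≤ u`, where `K(s,·)` is carried by `[0,u]`. As `L²`-limits of centered Gaussian variables are
Gaussian, `Y` is independent of the past and has law `N(0, ρ̂²(t|u))` (`IsRIGV.exists_innovation`).
Since `X_t = X_u - ∫ Ψ dX + Y` with the first two terms determined by the past, the conditional
variance of `X_t` is `ρ̂²(t|u)`; and since `S_t = S_u exp(β(u,t) - ∫ Ψ dX + Y)` and `S` generates the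
same filtration as `X`, the prediction formula results from integrating out the independent `Y`.
-/

namespace GaussVolterra

/-! ### Gaussian subspaces of `L²(P)` -/

section GaussianHilbertSpace

variable {Ω : Type*} [MeasurableSpace Ω] {P : Measure Ω}

/-- A subspace of `L²(P)` on which every element `ξ` has law `N(0, ‖ξ‖²)` can be closed up: along an
almost surely convergent subsequence both the characteristic functions and the norms converge. -/
theorem map_eq_gaussianReal_of_mem_topologicalClosure [IsProbabilityMeasure P]
    {V : Submodule ℝ (Lp ℝ 2 P)}
    (hV : ∀ ξ ∈ V, P.map ξ = gaussianReal 0 (‖ξ‖₊ ^ 2)) {ξ : Lp ℝ 2 P}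
    (hξ : ξ ∈ V.topologicalClosure) : P.map ξ = gaussianReal 0 (‖ξ‖₊ ^ 2) := by
  obtain ⟨x, hxV, hx⟩ := mem_closure_iff_seq_limit.1 hξ
  obtain ⟨ns, hns, hae⟩ := (tendstoInMeasure_of_tendsto_Lp hx).exists_seq_tendsto_ae
  have hchar (ζ : Lp ℝ 2 P) (t : ℝ) :
      charFun (P.map ζ) t = ∫ ω, Complex.exp (t * ζ ω * Complex.I) ∂P := by
    rw [charFun_apply_real, integral_map (Lp.aestronglyMeasurable ζ).aemeasurable]
    exact (by fun_prop : Measurable fun y : ℝ =>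
      Complex.exp (t * y * Complex.I)).aestronglyMeasurable
  have : IsProbabilityMeasure (P.map ξ) :=
    Measure.isProbabilityMeasure_map (Lp.aestronglyMeasurable ξ).aemeasurable
  refine Measure.ext_of_charFun (funext fun t => ?_)
  have h1 : Tendsto (fun n => charFun (P.map (x (ns n))) t) atTop (𝓝 (charFun (P.map ξ) t)) := by
    simp only [hchar]
    refine tendsto_integral_of_dominated_convergence (fun _ => 1) (fun n => ?_)
      (integrable_const 1) (fun n => .of_forall fun ω => ?_) ?_
    · exact (by fun_prop : Measurable fun y : ℝ =>
        Complex.exp (t * y * Complex.I)).comp_aemeasurable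
        (Lp.aestronglyMeasurable (x (ns n))).aemeasurable |>.aestronglyMeasurable
    · rw [← Complex.ofReal_mul, Complex.norm_exp_ofReal_mul_I]
    · filter_upwards [hae] with ω hω
      exact ((by fun_prop : Continuous fun y : ℝ =>
        Complex.exp (t * y * Complex.I)).tendsto (ξ ω)).comp hω
  have h2 : Tendsto (fun n => charFun (P.map (x (ns n))) t) atTop
      (𝓝 (charFun (gaussianReal 0 (‖ξ‖₊ ^ 2)) t)) := by
    have h3 : ∀ n, charFun (P.map (x (ns n))) t
        = Complex.exp (-((‖x (ns n)‖ ^ 2 * t ^ 2 / 2 : ℝ) : ℂ)) := by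
      intro n
      rw [hV _ (hxV _), charFun_gaussianReal]
      congr 1
      push_cast
      simp
    have h4 : charFun (gaussianReal 0 (‖ξ‖₊ ^ 2)) t
        = Complex.exp (-((‖ξ‖ ^ 2 * t ^ 2 / 2 : ℝ) : ℂ)) := by
      rw [charFun_gaussianReal]
      congr 1
      push_cast
      simp
    simp only [h3, h4]
    exact ((by fun_prop : Continuous fun ζ : Lp ℝ 2 P =>
      Complex.exp (-((‖ζ‖ ^ 2 * t ^ 2 / 2 : ℝ) : ℂ))).tendsto ξ).comp
        (hx.comp hns.tendsto_atTop)
  exact tendsto_nhds_unique h1 h2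

theorem isGaussianProcess_of_mem {V : Submodule ℝ (Lp ℝ 2 P)}
    (hV : ∀ ξ ∈ V, P.map ξ = gaussianReal 0 (‖ξ‖₊ ^ 2)) {ι : Type*} {ξ : ι → Lp ℝ 2 P}
    (hξ : ∀ i, ξ i ∈ V) {Y : ι → Ω → ℝ} (hY : ∀ i, Y i =ᵐ[P] ξ i) :
    IsGaussianProcess Y P := by
  classical
  have hYm : ∀ i, AEMeasurable (Y i) P := fun i =>
    (Lp.aestronglyMeasurable (ξ i)).aemeasurable.congr (hY i).symm
  -- Linear images of finite-dimensional marginals are again elements of the subspace.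
  refine ⟨fun I => ⟨isGaussian_of_map_eq_gaussianReal fun L => ?_⟩⟩
  have hYI : AEMeasurable (fun ω => I.restrict (Y · ω)) P :=
    aemeasurable_pi_lambda _ fun i => hYm i
  set ζ : Lp ℝ 2 P := ∑ i : I, L (Pi.single i 1) • ξ i with hζdef
  have hζ : ζ ∈ V := V.sum_mem fun i _ => V.smul_mem _ (hξ i)
  refine ⟨0, ‖ζ‖₊ ^ 2, ?_⟩
  rw [AEMeasurable.map_map_of_aemeasurable L.continuous.measurable.aemeasurable hYI, ← hV ζ hζ]
  refine Measure.map_congr ?_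
  have h1 : ⇑ζ =ᵐ[P] fun ω => ∑ i : I, L (Pi.single i 1) * ξ i ω := by
    have h2 : ∀ i : I, ⇑(L (Pi.single i 1) • ξ i) =ᵐ[P] fun ω => L (Pi.single i 1) * ξ i ω :=
      fun i => Lp.coeFn_smul _ _
    filter_upwards [Lp.coeFn_fun_finsetSum Finset.univ fun i : I => L (Pi.single i 1) • ξ i,
      ae_all_iff.2 h2] with ω h3 h4
    rw [hζdef, h3]
    exact Finset.sum_congr rfl fun i _ => h4 i
  filter_upwards [h1, ae_all_iff.2 fun i : I => hY i] with ω h3 h4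
  have h5 := L.toLinearMap.pi_apply_eq_sum_univ (I.restrict (Y · ω))
  simp only [ContinuousLinearMap.coe_coe] at h5
  rw [h3, Function.comp_apply, h5]
  refine Finset.sum_congr rfl fun i _ => ?_
  rw [smul_eq_mul, mul_comm, ← h4 i]
  congr 2
  ext j
  simp [Pi.single_apply, eq_comm]

/-- In a Gaussian Hilbert space, orthogonality to a family is independence of the whole family. -/
theorem indepFun_of_inner_eq_zero [IsProbabilityMeasure P] {V : Submodule ℝ (Lp ℝ 2 P)}
    (hV : ∀ ξ ∈ V, P.map ξ = gaussianReal 0 (‖ξ‖₊ ^ 2)) {ι : Type*} {ξ : ι → Lp ℝ 2 P}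
    (hξ : ∀ i, ξ i ∈ V) {X : ι → Ω → ℝ} (hX : ∀ i, X i =ᵐ[P] ξ i)
    {η : Lp ℝ 2 P} (hη : η ∈ V) {Y : Ω → ℝ} (hY : Y =ᵐ[P] η)
    (h0 : ∀ i, inner ℝ (ξ i) η = 0) :
    IndepFun (fun ω i => X i ω) Y P := by
  have hXm : ∀ i, MemLp (X i) 2 P := fun i => (Lp.memLp (ξ i)).ae_eq (hX i).symm
  have hYm : MemLp Y 2 P := (Lp.memLp η).ae_eq hY.symm
  have hgauss : IsGaussianProcess (Sum.elim X fun _ : Unit => Y) P := by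
    refine isGaussianProcess_of_mem hV (ξ := Sum.elim ξ fun _ => η) ?_ ?_
    · rintro (i | i)
      exacts [hξ i, hη]
    · rintro (i | i)
      exacts [hX i, hY]
  have hmean : ∫ ω, Y ω ∂P = 0 := by
    rw [← integral_map (φ := Y) (f := fun y => y) hYm.1.aemeasurable
      measurable_id.aestronglyMeasurable, Measure.map_congr hY, hV η hη]
    exact integral_id_gaussianReal
  have := hgauss.indepFun_of_covariance_eq_zero (fun i => (hXm i).1.aemeasurable)
    (fun _ => hYm.1.aemeasurable) (fun i _ => by
      rw [covariance_eq_sub (hXm i) hYm, hmean, mul_zero, sub_zero, ← h0 i, L2.inner_def]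
      refine integral_congr_ae ?_
      filter_upwards [hX i, hY] with ω h1 h2
      simp [h1, h2, mul_comm])
  exact this.comp measurable_id (measurable_pi_apply ())

end GaussianHilbertSpace

/-! ### Conditioning on an independent variable -/

section ConditionalExpectation

variable {Ω : Type*} [MeasurableSpace Ω] {P : Measure Ω} [IsProbabilityMeasure P]

/-- If `Y` is independent of `U`, then conditioning `h(U, Y)` on `U` integrates out `Y` with `U`
frozen. -/
theorem condExp_comap_of_indepFun {β : Type*} [MeasurableSpace β] {U : Ω → β}
    (hU : Measurable U) {Y : Ω → ℝ} (hY : AEMeasurable Y P) (hUY : IndepFun U Y P)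
    {h : β × ℝ → ℝ} (hh : Measurable h) (hint : Integrable (fun ω => h (U ω, Y ω)) P) :
    (∀ᵐ ω ∂P, Integrable (fun y => h (U ω, y)) (P.map Y)) ∧
    P[fun ω => h (U ω, Y ω) | MeasurableSpace.comap U inferInstance]
      =ᵐ[P] fun ω => ∫ y, h (U ω, y) ∂P.map Y := by
  have hprod : P.map (fun ω => (U ω, Y ω)) = (P.map U).prod (P.map Y) :=
    (indepFun_iff_map_prod_eq_prod_map_map hU.aemeasurable hY).1 hUY
  have : IsProbabilityMeasure (P.map U) := Measure.isProbabilityMeasure_map hU.aemeasurable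
  have : IsProbabilityMeasure (P.map Y) := Measure.isProbabilityMeasure_map hY
  have hint' : Integrable h ((P.map U).prod (P.map Y)) := by
    rw [← hprod, integrable_map_measure hh.aestronglyMeasurable (hU.aemeasurable.prodMk hY)]
    exact hint
  refine ⟨ae_of_ae_map hU.aemeasurable hint'.prod_right_ae, ?_⟩
  have hk : condDistrib Y U P =ᵐ[P.map U] Kernel.const β (P.map Y) := by
    refine condDistrib_ae_eq_of_measure_eq_compProd U hY ?_
    rw [hprod, Measure.compProd_const]
  filter_upwards [condExp_prod_ae_eq_integral_condDistrib hU hY hh.stronglyMeasurable hint,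
    ae_of_ae_map hU.aemeasurable hk] with ω h1 h2
  rw [h1, h2, Kernel.const_apply]

end ConditionalExpectation

/-! ### Square integrable families and their linear combinations -/

section TruncatedLp

variable {α : Type*} [MeasurableSpace α]

open Classical in
/-- The class of `F r` in `L²(ν)`, and `0` for `r ∉ I` (or if `F r` is not square integrable). The
value `0` off `I` makes the family total in `r`, so that coefficients `c : ℝ →₀ ℝ` can be applied
to it and inner product identities between two such families hold for all indices. -/
noncomputable def truncLp (ν : Measure α) (I : Set ℝ) (F : ℝ → α → ℝ) (r : ℝ) : Lp ℝ 2 ν :=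
  if h : r ∈ I ∧ MemLp (F r) 2 ν then h.2.toLp (F r) else 0

theorem coeFn_truncLp {ν : Measure α} {I : Set ℝ} {F : ℝ → α → ℝ} {r : ℝ} (hr : r ∈ I)
    (hF : MemLp (F r) 2 ν) : truncLp ν I F r =ᵐ[ν] F r := by
  rw [truncLp, dif_pos ⟨hr, hF⟩]
  exact hF.coeFn_toLp

theorem truncLp_of_notMem {ν : Measure α} {I : Set ℝ} {F : ℝ → α → ℝ} {r : ℝ} (hr : r ∉ I) :
    truncLp ν I F r = 0 := by
  rw [truncLp, dif_neg fun h => hr h.1]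

theorem coeFn_linearCombination_truncLp {ν : Measure α} {I : Set ℝ} {F : ℝ → α → ℝ}
    (hF : ∀ r ∈ I, MemLp (F r) 2 ν) {c : ℝ →₀ ℝ} (hc : ∀ r ∈ c.support, r ∈ I) :
    Finsupp.linearCombination ℝ (truncLp ν I F) c =ᵐ[ν] fun a => c.sum fun r b => b * F r a := by
  have h1 : ∀ r : c.support, ⇑(c r • truncLp ν I F r) =ᵐ[ν] fun a => c r * F r a := by
    intro r
    filter_upwards [Lp.coeFn_smul (c r) (truncLp ν I F r),
      coeFn_truncLp (hc r r.2) (hF r (hc r r.2))] with a h2 h3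
    rw [h2, Pi.smul_apply, h3, smul_eq_mul]
  rw [Finsupp.linearCombination_apply, Finsupp.sum]
  filter_upwards [Lp.coeFn_fun_finsetSum c.support fun r => c r • truncLp ν I F r,
    ae_all_iff.2 h1] with a h2 h3
  rw [h2]
  exact Finset.sum_congr rfl fun r hr => h3 ⟨r, hr⟩

theorem tendsto_linearCombination_truncLp_iff {ν : Measure α} {I : Set ℝ} {F : ℝ → α → ℝ}
    (hF : ∀ r ∈ I, MemLp (F r) 2 ν) {Φ : ℕ → ℝ →₀ ℝ} (hΦ : ∀ n, ∀ r ∈ (Φ n).support, r ∈ I)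
    {G : ℕ → α → ℝ} (hG : ∀ n, G n =ᵐ[ν] fun a => (Φ n).sum fun r b => b * F r a)
    {g : α → ℝ} (hg : MemLp g 2 ν) :
    Tendsto (fun n => Finsupp.linearCombination ℝ (truncLp ν I F) (Φ n)) atTop
        (𝓝 (hg.toLp g)) ↔
      Tendsto (fun n => eLpNorm (fun a => G n a - g a) 2 ν) atTop (𝓝 0) := by
  rw [Lp.tendsto_Lp_iff_tendsto_eLpNorm]
  refine tendsto_congr fun n => eLpNorm_congr_ae ?_
  filter_upwards [hG n, coeFn_linearCombination_truncLp hF (hΦ n)] with a h1 h2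
  rw [Pi.sub_apply, h1, h2]

end TruncatedLp

/-! ### Families with equal Gram matrices -/

section IsometricFamilies

variable {ι E F : Type*} [NormedAddCommGroup E] [InnerProductSpace ℝ E]
  [NormedAddCommGroup F] [InnerProductSpace ℝ F] {x : ι → E} {k : ι → F}

theorem inner_linearCombination_eq (h : ∀ i j, inner ℝ (x i) (x j) = inner ℝ (k i) (k j))
    (c d : ι →₀ ℝ) :
    inner ℝ (Finsupp.linearCombination ℝ x c) (Finsupp.linearCombination ℝ x d)
      = inner ℝ (Finsupp.linearCombination ℝ k c) (Finsupp.linearCombination ℝ k d) := by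
  simp only [Finsupp.linearCombination_apply, Finsupp.sum, sum_inner, inner_sum,
    inner_smul_left, inner_smul_right, h]

theorem norm_linearCombination_eq (h : ∀ i j, inner ℝ (x i) (x j) = inner ℝ (k i) (k j))
    (c : ι →₀ ℝ) :
    ‖Finsupp.linearCombination ℝ x c‖ = ‖Finsupp.linearCombination ℝ k c‖ := by
  rw [@norm_eq_sqrt_real_inner E, @norm_eq_sqrt_real_inner F, inner_linearCombination_eq h]

/-- Families with the same Gram matrix are related by an isometry of their spans. -/
theorem cauchySeq_linearCombination (h : ∀ i j, inner ℝ (x i) (x j) = inner ℝ (k i) (k j))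
    {Φ : ℕ → ι →₀ ℝ} (hk : CauchySeq fun n => Finsupp.linearCombination ℝ k (Φ n)) :
    CauchySeq fun n => Finsupp.linearCombination ℝ x (Φ n) := by
  rw [Metric.cauchySeq_iff] at hk ⊢
  simpa only [dist_eq_norm, ← map_sub, norm_linearCombination_eq h] using hk

/-- The isometry between the spans of two families with the same Gram matrix extends to limits. -/
theorem inner_lim_eq (h : ∀ i j, inner ℝ (x i) (x j) = inner ℝ (k i) (k j))
    {Φ Θ : ℕ → ι →₀ ℝ} {a b : E} {a' b' : F}
    (ha : Tendsto (fun n => Finsupp.linearCombination ℝ x (Φ n)) atTop (𝓝 a))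
    (ha' : Tendsto (fun n => Finsupp.linearCombination ℝ k (Φ n)) atTop (𝓝 a'))
    (hb : Tendsto (fun n => Finsupp.linearCombination ℝ x (Θ n)) atTop (𝓝 b))
    (hb' : Tendsto (fun n => Finsupp.linearCombination ℝ k (Θ n)) atTop (𝓝 b')) :
    inner ℝ a b = inner ℝ a' b' := by
  refine tendsto_nhds_unique (ha.inner hb) ?_
  simp only [inner_linearCombination_eq h]
  exact ha'.inner hb'

end IsometricFamilies

/-! ### The operator `K*` on step functions and its range -/

section Kernel

variable {T : ℝ} {m : StieltjesFunction ℝ} {K : ℝ → ℝ → ℝ}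

instance : IsFiniteMeasure (dm T m) :=
  ⟨by rw [dm, Measure.restrict_apply_univ, m.measure_Ioc]; exact ENNReal.ofReal_lt_top⟩

theorem IsRegularKernel.measure_singleton (hK : IsRegularKernel T m K) (r : ℝ) :
    dm T m {r} = 0 := by
  rw [dm, Measure.restrict_apply (measurableSet_singleton r)]
  by_cases hr : r ∈ Ioc 0 T
  · rw [inter_eq_left.2 (singleton_subset_iff.2 hr), m.measure_singleton]
    have h : Tendsto m (𝓝[<] r) (𝓝 (m r)) := by
      refine (hK.m_continuousOn r ⟨hr.1.le, hr.2⟩).mono_of_mem_nhdsWithin ?_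
      filter_upwards [Ioo_mem_nhdsLT hr.1] with x hx
      exact ⟨hx.1.le, hx.2.le.trans hr.2⟩
    rw [leftLim_eq_of_tendsto h, sub_self, ENNReal.ofReal_zero]
  · rw [singleton_inter_eq_empty.2 hr, measure_empty]

theorem IsRegularKernel.ae_ne (hK : IsRegularKernel T m K) (r : ℝ) : ∀ᵐ s ∂dm T m, s ≠ r := by
  rw [ae_iff]
  simpa using hK.measure_singleton r

theorem ae_mem_Ioc : ∀ᵐ s ∂dm T m, s ∈ Ioc 0 T := ae_restrict_mem measurableSet_Ioc

theorem setIntegral_dm {u : ℝ} (hu : u ≤ T) (f : ℝ → ℝ) :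
    ∫ v in Ioc 0 u, f v ∂m.measure = ∫ v in Iic u, f v ∂dm T m := by
  rw [dm, Measure.restrict_restrict measurableSet_Iic]
  congr 2
  ext v
  simp only [mem_Ioc, mem_inter_iff, mem_Iic]
  exact ⟨fun h => ⟨h.2, h.1, h.2.trans hu⟩, fun h => ⟨h.2.1, h.1⟩⟩

theorem IsRegularKernel.integral_mul_eq (hK : IsRegularKernel T m K) {r s : ℝ}
    (hr : r ∈ Icc 0 T) (hs : s ∈ Icc 0 T) :
    ∫ v in Ioc 0 (min r s), K r v * K s v ∂m.measure = ∫ v, K r v * K s v ∂dm T m := by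
  rw [setIntegral_dm ((min_le_left r s).trans hr.2), ← integral_indicator measurableSet_Iic]
  refine integral_congr_ae ?_
  filter_upwards [ae_mem_Ioc] with v hv
  by_cases h : v ∈ Iic (min r s)
  · rw [indicator_of_mem h]
  · rw [indicator_of_notMem h]
    rcases min_lt_iff.1 (not_le.1 fun h' => h (mem_Iic.2 h')) with h | h
    · rw [hK.volterra r hr v ⟨hv.1.le, hv.2⟩ h, zero_mul]
    · rw [hK.volterra s hs v ⟨hv.1.le, hv.2⟩ h, mul_zero]

theorem IsRegularKernel.intervalIntegrable_partialT (hK : IsRegularKernel T m K) {r s : ℝ}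
    (hs : 0 < s) (hsr : s < r) (hrT : r ≤ T) :
    IntervalIntegrable (fun t => partialT T K t s) volume r T := by
  refine ContinuousOn.intervalIntegrable_of_Icc hrT ?_
  have hmaps : MapsTo (fun t : ℝ => (t, s)) (Icc r T)
      {p : ℝ × ℝ | 0 < p.2 ∧ p.2 < p.1 ∧ p.1 ≤ T} := fun t ht => ⟨hs, hsr.trans_le ht.1, ht.2⟩
  exact hK.continuousOn_partialT.comp (by fun_prop) hmaps

theorem IsRegularKernel.integral_partialT (hK : IsRegularKernel T m K) {r s : ℝ}
    (hs : 0 < s) (hsr : s < r) (hrT : r ≤ T) :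
    ∫ t in r..T, partialT T K t s = K T s - K r s := by
  refine intervalIntegral.integral_eq_sub_of_hasDerivAt_of_le hrT (f := fun t => K t s) ?_ ?_
    (hK.intervalIntegrable_partialT hs hsr hrT)
  · intro t ht
    exact (hK.differentiable s t hs (lt_of_lt_of_le hsr ht.1) ht.2).continuousWithinAt.mono
      (Icc_subset_Icc_left (hs.trans hsr).le)
  · intro t ht
    exact (hK.differentiable s t hs (hsr.trans ht.1) ht.2.le).hasDerivWithinAt.hasDerivAt
      (Icc_mem_nhds ((hs.trans hsr).trans ht.1) ht.2)

/-- `K* 1_{[0,r)} = K(r,·)` off the point `r`. The increment `1_{[0,r)}(t) - 1_{[0,r)}(s)` times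
`∂K/∂t` is integrable even though `∂K/∂t` may blow up on the diagonal: the increment vanishes for
`t` near `s`. -/
theorem IsRegularKernel.integral_indicator_sub (hK : IsRegularKernel T m K) {r s : ℝ}
    (hr : r ∈ Icc 0 T) (hs : s ∈ Ioc 0 T) (hrs : s ≠ r) :
    IntervalIntegrable (fun t => ((Ico 0 r).indicator (fun _ => (1 : ℝ)) t
      - (Ico 0 r).indicator (fun _ => (1 : ℝ)) s) * partialT T K t s) volume s T ∧
    (Ico 0 r).indicator (fun _ => (1 : ℝ)) s * K T s
      + ∫ t in s..T, ((Ico 0 r).indicator (fun _ => (1 : ℝ)) t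
      - (Ico 0 r).indicator (fun _ => (1 : ℝ)) s) * partialT T K t s = K r s := by
  rcases lt_or_gt_of_ne hrs with h | h
  · have h1 : (Ico 0 r).indicator (fun _ => (1 : ℝ)) s = 1 :=
      indicator_of_mem (show s ∈ Ico 0 r from ⟨hs.1.le, h⟩) _
    rw [h1]
    have e1 : EqOn (fun _ => (0 : ℝ)) (fun t => ((Ico 0 r).indicator (fun _ => (1 : ℝ)) t - 1)
        * partialT T K t s) (uIoo s r) := by
      intro t ht
      rw [uIoo_of_le h.le] at ht
      simp [indicator_of_mem (show t ∈ Ico 0 r from ⟨(hs.1.trans ht.1).le, ht.2⟩)]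
    have e2 : EqOn (fun t => -partialT T K t s)
        (fun t => ((Ico 0 r).indicator (fun _ => (1 : ℝ)) t - 1)
        * partialT T K t s) (uIoo r T) := by
      intro t ht
      rw [uIoo_of_le hr.2] at ht
      simp [indicator_of_notMem (show t ∉ Ico 0 r from fun h' => absurd h'.2 ht.1.not_gt)]
    have i1 := (intervalIntegrable_const (μ := volume) (c := (0 : ℝ))).congr_uIoo e1
    have i2 := (hK.intervalIntegrable_partialT hs.1 h hr.2).neg.congr_uIoo e2
    refine ⟨i1.trans i2, ?_⟩
    rw [← intervalIntegral.integral_add_adjacent_intervals i1 i2,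
      ← intervalIntegral.integral_congr_uIoo e1, ← intervalIntegral.integral_congr_uIoo e2,
      intervalIntegral.integral_neg, hK.integral_partialT hs.1 h hr.2]
    simp
  · have h1 : (Ico 0 r).indicator (fun _ => (1 : ℝ)) s = 0 :=
      indicator_of_notMem (fun h' => absurd h'.2 h.not_gt) _
    rw [h1]
    have e1 : EqOn (fun _ => (0 : ℝ)) (fun t => ((Ico 0 r).indicator (fun _ => (1 : ℝ)) t - 0)
        * partialT T K t s) (uIoo s T) := by
      intro t ht
      rw [uIoo_of_le hs.2] at ht
      simp [indicator_of_notMem (show t ∉ Ico 0 r from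
        fun h' => absurd (h'.2.trans h) ht.1.not_gt)]
    refine ⟨intervalIntegrable_const.congr_uIoo e1, ?_⟩
    rw [← intervalIntegral.integral_congr_uIoo e1, hK.volterra r hr s ⟨hs.1.le, hs.2⟩ h]
    simp

/-- `K* 1_{[0,r)} = K(r,·)`, extended linearly. The diagonal point `s = r` has to be excluded. -/
theorem IsRegularKernel.kStar_stepFun (hK : IsRegularKernel T m K) {c : ℝ →₀ ℝ}
    (hc : ∀ r ∈ c.support, r ∈ Icc 0 T) :
    kStar T K (stepFun c) =ᵐ[dm T m] fun s => c.sum fun r a => a * K r s := by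
  filter_upwards [ae_mem_Ioc, (ae_ball_iff c.support.countable_toSet).2 fun r _ => hK.ae_ne r]
    with s hs hne
  have key := fun r (hr : r ∈ c.support) => hK.integral_indicator_sub (hc r hr) hs (hne r hr)
  have e : ∀ t, (stepFun c t - stepFun c s) * partialT T K t s
      = ∑ r ∈ c.support, c r * (((Ico 0 r).indicator (fun _ => (1 : ℝ)) t
      - (Ico 0 r).indicator (fun _ => (1 : ℝ)) s) * partialT T K t s) := by
    intro t
    simp only [stepFun, Finsupp.sum]
    rw [← Finset.sum_sub_distrib, Finset.sum_mul]
    exact Finset.sum_congr rfl fun r _ => by ring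
  rw [kStar]
  simp only [e]
  rw [intervalIntegral.integral_finsetSum fun r hr => (key r hr).1.const_mul (c r)]
  simp only [intervalIntegral.integral_const_mul, stepFun, Finsupp.sum]
  rw [Finset.sum_mul, ← Finset.sum_add_distrib]
  refine Finset.sum_congr rfl fun r hr => ?_
  rw [← (key r hr).2]
  ring

/-- In `L²(dm)`, solving `K* Φ = g` on `[0,u)` is approximating `g` by combinations of the `K(r,·)`,
`r ≤ u`. -/
theorem IsRegularKernel.isKStarInverse_iff (hK : IsRegularKernel T m K) {u : ℝ}
    (hu : u ∈ Icc 0 T) {g : ℝ → ℝ} (hg : MemLp g 2 (dm T m)) {Φ : ℕ → ℝ →₀ ℝ} :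
    IsKStarInverse T m K u g Φ ↔ (∀ n, ∀ r ∈ (Φ n).support, r ∈ Icc 0 u) ∧
      Tendsto (fun n => Finsupp.linearCombination ℝ (truncLp (dm T m) (Icc 0 T) K) (Φ n)) atTop
        (𝓝 (hg.toLp g)) := by
  have key (h : ∀ n, ∀ r ∈ (Φ n).support, r ∈ Icc 0 u) :=
    have h' : ∀ n, ∀ r ∈ (Φ n).support, r ∈ Icc 0 T :=
      fun n r hr => Icc_subset_Icc_right hu.2 (h n r hr)
    tendsto_linearCombination_truncLp_iff hK.memLp_section h' (fun n => hK.kStar_stepFun (h' n)) hg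
  exact ⟨fun h => ⟨h.1, (key h.1).2 h.2⟩, fun h => ⟨h.1, (key h.1).1 h.2⟩⟩

theorem ae_eq_zero_of_forall_integral_indicator {u : ℝ} {h : ℝ → ℝ} (hint : Integrable h (dm T m))
    (h0 : ∀ r ∈ Icc 0 u, ∫ v in Ico 0 r, h v ∂dm T m = 0) :
    ∀ᵐ v ∂dm T m, v < u → h v = 0 := by
  rcases lt_or_ge u 0 with hu | hu
  · filter_upwards [ae_mem_Ioc] with v hv hvu
    exact absurd (hv.1.trans hvu) hu.not_gt
  -- `dm` does not charge `(-∞, 0]`, so the half-lines may replace the intervals `[0,r)`.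
  have hpos : ∀ r, ∫ v in Iio r, h v ∂dm T m = ∫ v in Ico 0 r, h v ∂dm T m := by
    intro r
    rw [← integral_indicator measurableSet_Iio, ← integral_indicator measurableSet_Ico]
    refine integral_congr_ae ?_
    filter_upwards [ae_mem_Ioc] with v hv
    simp [indicator, hv.1.le]
  have h0' : ∀ r ≤ u, ∫ v in Iio r, h v ∂dm T m = 0 := by
    intro r hr
    rw [hpos]
    rcases lt_or_ge r 0 with h | h
    · rw [Ico_eq_empty (not_lt.2 h.le)]
      simp
    · exact h0 r ⟨h, hr⟩
  have hall : ∀ s, MeasurableSet s → ∫ v in s, h v ∂(dm T m).restrict (Iio u) = 0 := by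
    refine MeasurableSpace.induction_on_inter
      (C := fun s _ => ∫ v in s, h v ∂(dm T m).restrict (Iio u) = 0)
      (BorelSpace.measurable_eq.trans (borel_eq_generateFrom_Iio ℝ)) isPiSystem_Iio
      (by simp) ?_ ?_ ?_
    · rintro _ ⟨r, rfl⟩
      rw [Measure.restrict_restrict measurableSet_Iio, Iio_inter_Iio]
      exact h0' _ (min_le_right r u)
    · intro s hs h1
      rw [setIntegral_compl hs hint.integrableOn, h1, h0' u le_rfl, sub_zero]
    · intro f hd hm hf
      rw [integral_iUnion hm hd hint.integrableOn.integrableOn]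
      simp [hf]
  have := (hint.integrableOn (s := Iio u)).ae_eq_zero_of_forall_setIntegral_eq_zero
    fun s hs _ => hall s hs
  exact (ae_restrict_iff' measurableSet_Iio).1 this

/-- If `K* Φ = 1_{[0,r)}` is solvable on `[0,r)` for each `r`, then `K* Φ = G` is solvable on
`[0,u)` for each square integrable `G` carried by `[0,u)`: a function orthogonal to all `K(r,·)`,
`r ≤ u`, is orthogonal to all `1_{[0,r)}`, hence vanishes on `[0,u)`. -/
theorem IsRegularKernel.exists_isKStarInverse (hK : IsRegularKernel T m K)
    (hinv : ∀ r ∈ Icc 0 T, ∃ Φ : ℕ → ℝ →₀ ℝ,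
      IsKStarInverse T m K r ((Ico 0 r).indicator fun _ => 1) Φ)
    {u : ℝ} (hu : u ∈ Icc 0 T) {g : ℝ → ℝ} (hg : MemLp ((Ico 0 u).indicator g) 2 (dm T m)) :
    ∃ Φ, IsKStarInverse T m K u ((Ico 0 u).indicator g) Φ := by
  set k := truncLp (dm T m) (Icc 0 T) K
  set M : Submodule ℝ (Lp ℝ 2 (dm T m)) := Submodule.span ℝ (k '' Icc 0 u)
  have hlim : ∀ Φ : ℕ → ℝ →₀ ℝ, (∀ n, ∀ r ∈ (Φ n).support, r ∈ Icc 0 u) → ∀ G,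
      Tendsto (fun n => Finsupp.linearCombination ℝ k (Φ n)) atTop (𝓝 G) →
      G ∈ M.topologicalClosure := by
    intro Φ hΦ G hG
    refine mem_closure_of_tendsto hG (.of_forall fun n => ?_)
    exact (Finsupp.mem_span_image_iff_linearCombination ℝ).2
      ⟨Φ n, (Finsupp.mem_supported ℝ _).2 fun r hr => hΦ n r hr, rfl⟩
  have hone (r : ℝ) : MemLp ((Ico 0 r).indicator fun _ => (1 : ℝ)) 2 (dm T m) :=
    (memLp_const 1).indicator measurableSet_Ico
  have hG : hg.toLp _ ∈ M.topologicalClosure := by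
    rw [← Submodule.orthogonal_orthogonal_eq_closure, Submodule.mem_orthogonal']
    intro h hh
    have hh' : h ∈ M.topologicalClosureᗮ := by rwa [Submodule.orthogonal_closure]
    have hz : ∀ᵐ v ∂dm T m, v < u → h v = 0 := by
      refine ae_eq_zero_of_forall_integral_indicator
        ((Lp.memLp h).integrable one_le_two) fun r hr => ?_
      have hrT : r ∈ Icc 0 T := Icc_subset_Icc_right hu.2 hr
      obtain ⟨Φ, hΦ⟩ := hinv r hrT
      obtain ⟨h1, h2⟩ := (hK.isKStarInverse_iff hrT (hone r)).1 hΦ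
      have h3 := (Submodule.mem_orthogonal' _ _).1 hh' _
        (hlim Φ (fun n s hs => Icc_subset_Icc_right hr.2 (h1 n s hs)) _ h2)
      rw [L2.inner_def] at h3
      rw [← integral_indicator measurableSet_Ico]
      refine (integral_congr_ae ?_).trans h3
      filter_upwards [(hone r).coeFn_toLp] with v hv
      rw [hv]
      by_cases hvr : v ∈ Ico 0 r <;> simp [hvr]
    rw [L2.inner_def]
    refine integral_eq_zero_of_ae ?_
    filter_upwards [hz, hg.coeFn_toLp] with v h1 h2
    rw [h2]
    by_cases hv : v ∈ Ico 0 u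
    · simp [h1 hv.2]
    · simp [hv]
  obtain ⟨y, hy, hyG⟩ := mem_closure_iff_seq_limit.1 hG
  have hy' : ∀ n, ∃ c ∈ Finsupp.supported ℝ ℝ (Icc 0 u), Finsupp.linearCombination ℝ k c = y n :=
    fun n => (Finsupp.mem_span_image_iff_linearCombination ℝ).1 (hy n)
  choose Φ hΦ hΦy using hy'
  refine ⟨Φ, (hK.isKStarInverse_iff hu hg).2
    ⟨fun n r hr => (Finsupp.mem_supported ℝ _).1 (hΦ n) hr, ?_⟩⟩
  simpa only [hΦy, k] using hyG

end Kernel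

/-! ### The isometry with `L²(dm)` and the innovation -/

section GaussianVolterra

variable {Ω : Type*} [MeasurableSpace Ω] {P : Measure Ω} {T : ℝ}
  {X : ℝ → Ω → ℝ} {m : StieltjesFunction ℝ} {K : ℝ → ℝ → ℝ}

theorem IsRIGV.memLp_two (hX : IsRIGV P T X m K) {r : ℝ} (hr : r ∈ Icc 0 T) : MemLp (X r) 2 P :=
  (hX.gaussian.hasGaussianLaw_eval ⟨r, hr⟩).memLp_two

/-- The covariance formula says that `X_r ↦ K(r,·)` is an isometry from `L²(P)` to `L²(dm)`. -/
theorem IsRIGV.inner_truncLp (hX : IsRIGV P T X m K) (r s : ℝ) :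
    inner ℝ (truncLp P (Icc 0 T) X r) (truncLp P (Icc 0 T) X s)
      = inner ℝ (truncLp (dm T m) (Icc 0 T) K r) (truncLp (dm T m) (Icc 0 T) K s) := by
  by_cases hr : r ∈ Icc 0 T
  swap
  · simp [truncLp_of_notMem hr]
  by_cases hs : s ∈ Icc 0 T
  swap
  · simp [truncLp_of_notMem hs]
  have h1 : inner ℝ (truncLp P (Icc 0 T) X r) (truncLp P (Icc 0 T) X s) = cov P X r s := by
    rw [L2.inner_def, cov]
    refine integral_congr_ae ?_
    filter_upwards [coeFn_truncLp hr (hX.memLp_two hr), coeFn_truncLp hs (hX.memLp_two hs)]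
      with ω h1 h2
    simp [h1, h2, mul_comm]
  have h2 : inner ℝ (truncLp (dm T m) (Icc 0 T) K r) (truncLp (dm T m) (Icc 0 T) K s)
      = ∫ v, K r v * K s v ∂dm T m := by
    rw [L2.inner_def]
    refine integral_congr_ae ?_
    filter_upwards [coeFn_truncLp hr (hX.regular.memLp_section r hr),
      coeFn_truncLp hs (hX.regular.memLp_section s hs)] with v h1 h2
    simp [h1, h2, mul_comm]
  rw [h1, h2, hX.cov_eq r hr s hs, hX.regular.integral_mul_eq hr hs]

theorem IsRIGV.isGaussianProcess_truncLp (hX : IsRIGV P T X m K) :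
    IsGaussianProcess (fun r ω => truncLp P (Icc 0 T) X r ω) P := by
  classical
  have h : IsGaussianProcess (fun (r : ℝ) ω => if r ∈ Icc 0 T then X r ω else 0) P := by
    refine hX.gaussian.of_isGaussianProcess fun r => ?_
    by_cases hr : r ∈ Icc 0 T
    · exact ⟨{⟨r, hr⟩}, ContinuousLinearMap.proj ⟨⟨r, hr⟩, by simp⟩, fun ω => by
        rw [if_pos hr]; rfl⟩
    · exact ⟨∅, 0, fun ω => by rw [if_neg hr]; rfl⟩
  refine h.congr fun r => ?_
  by_cases hr : r ∈ Icc 0 T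
  · filter_upwards [coeFn_truncLp hr (hX.memLp_two hr)] with ω hω
    rw [if_pos hr, hω]
  · rw [truncLp_of_notMem hr]
    filter_upwards [Lp.coeFn_zero ℝ 2 P] with ω hω
    rw [if_neg hr, hω, Pi.zero_apply]

theorem IsRIGV.map_eq_gaussianReal_of_mem_span (hX : IsRIGV P T X m K) {ζ : Lp ℝ 2 P}
    (hζ : ζ ∈ Submodule.span ℝ (range (truncLp P (Icc 0 T) X))) :
    P.map ζ = gaussianReal 0 (‖ζ‖₊ ^ 2) := by
  have := hX.isGaussianProcess_truncLp.isProbabilityMeasure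
  set ξ := truncLp P (Icc 0 T) X
  have hmean : ∀ r, ∫ ω, ξ r ω ∂P = 0 := by
    intro r
    by_cases hr : r ∈ Icc 0 T
    · rw [integral_congr_ae (coeFn_truncLp hr (hX.memLp_two hr)), hX.centered r hr]
    · rw [show ξ r = 0 from truncLp_of_notMem hr, integral_congr_ae (Lp.coeFn_zero ℝ 2 P)]
      simp
  obtain ⟨c, rfl⟩ := Finsupp.mem_span_range_iff_exists_finsupp.1 hζ
  set ζ : Lp ℝ 2 P := c.sum fun i a => a • ξ i with hζdef
  have hsum : ⇑ζ =ᵐ[P] fun ω => ∑ r ∈ c.support, c r • ξ r ω := by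
    rw [hζdef, Finsupp.sum]
    filter_upwards [Lp.coeFn_fun_finsetSum c.support fun r => c r • ξ r,
      ae_all_iff.2 fun r : c.support => Lp.coeFn_smul (c r) (ξ r)] with ω h1 h2
    rw [h1]
    exact Finset.sum_congr rfl fun r hr => h2 ⟨r, hr⟩
  have hgauss : HasGaussianLaw ζ P :=
    ((hX.isGaussianProcess_truncLp.smul c).hasGaussianLaw_fun_sum (I := c.support)).congr hsum.symm
  have hζ0 : ∫ ω, ζ ω ∂P = 0 := by
    rw [integral_congr_ae hsum, integral_finsetSum]
    · simp [integral_const_mul, hmean]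
    · exact fun r _ => ((Lp.memLp (ξ r)).integrable one_le_two).smul (c r)
  have hvar : Var[ζ; P] = ‖ζ‖ ^ 2 := by
    rw [variance_of_integral_eq_zero (Lp.aestronglyMeasurable ζ).aemeasurable hζ0,
      ← real_inner_self_eq_norm_sq, L2.inner_def]
    exact integral_congr_ae (.of_forall fun ω => by simp [sq])
  rw [hgauss.map_eq_gaussianReal, hζ0, hvar]
  congr 1
  rw [Real.toNNReal_pow (norm_nonneg _), norm_toNNReal]

theorem past_eq_comap {Ω : Type*} {X : ℝ → Ω → ℝ} {u : ℝ} :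
    past X u = MeasurableSpace.comap (fun ω (s : Icc 0 u) => X s ω) inferInstance := by
  simp only [past, inferInstance, MeasurableSpace.pi, MeasurableSpace.comap_iSup,
    MeasurableSpace.comap_comp, iSup_subtype']
  rfl

/-- Prices and `X` generate the same information, as `x ↦ S₀ exp(b + x)` is a measurable
embedding. -/
theorem past_price (μ : ℝ → ℝ) {S₀ : ℝ} (hS₀ : S₀ ≠ 0) (u : ℝ) :
    past (price P T X μ S₀) u = past X u := by
  simp only [past]
  refine iSup_congr fun s => iSup_congr fun _ => ?_
  have he : MeasurableEmbedding fun x : ℝ => S₀ * Real.exp (beta P T X μ 0 s + x) := by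
    refine Continuous.measurableEmbedding (by fun_prop) fun x y hxy => ?_
    simpa [hS₀] using hxy
  have : price P T X μ S₀ s = (fun x : ℝ => S₀ * Real.exp (beta P T X μ 0 s + x)) ∘ X s := rfl
  rw [this, ← MeasurableSpace.comap_comp, he.comap_eq]

/-- The quadratic variation enters only through the additivity of `β`, whatever its value. -/
theorem price_eq_mul_exp (μ : ℝ → ℝ) (S₀ u t : ℝ) (ω : Ω) :
    price P T X μ S₀ t ω
      = price P T X μ S₀ u ω * Real.exp (beta P T X μ u t + (X t ω - X u ω)) := by
  rw [price, price, mul_assoc, ← Real.exp_add]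
  congr 2
  simp only [beta]
  ring

theorem IsRIGV.memLp_psi (hX : IsRIGV P T X m K) {u t : ℝ} (hu : u ∈ Icc 0 T)
    (ht : t ∈ Icc 0 T) : MemLp ((Ico 0 u).indicator fun s => K u s - K t s) 2 (dm T m) :=
  ((hX.regular.memLp_section u hu).sub (hX.regular.memLp_section t ht)).indicator
    measurableSet_Ico

theorem IsRIGV.exists_isWienerIntegral (hX : IsRIGV P T X m K) {u : ℝ} (hu : u ∈ Icc 0 T)
    {g : ℝ → ℝ} (hg : MemLp g 2 (dm T m)) {Φ : ℕ → ℝ →₀ ℝ} (hΦ : IsKStarInverse T m K u g Φ) :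
    ∃ Z, IsWienerIntegral P X Φ Z := by
  obtain ⟨h1, h2⟩ := (hX.regular.isKStarInverse_iff hu hg).1 hΦ
  obtain ⟨ζ, hζ⟩ := cauchySeq_tendsto_of_complete
    (cauchySeq_linearCombination hX.inner_truncLp h2.cauchySeq)
  refine ⟨ζ, Lp.memLp ζ, ?_⟩
  refine (tendsto_linearCombination_truncLp_iff (fun r hr => hX.memLp_two hr)
    (fun n r hr => Icc_subset_Icc_right hu.2 (h1 n r hr)) (fun n => EventuallyEq.rfl)
    (Lp.memLp ζ)).1 ?_
  rwa [Lp.toLp_coeFn]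

/-- Up to a null set, the Wiener integral of an integrand on `[0,u)` is a measurable function of the
path up to time `u`, as an almost sure limit of a subsequence of step integrals. -/
theorem IsWienerIntegral.exists_measurable_comp {Φ : ℕ → ℝ →₀ ℝ} {Z : Ω → ℝ}
    (hZ : IsWienerIntegral P X Φ Z) {u : ℝ} (hX : ∀ s ∈ Icc 0 u, AEStronglyMeasurable (X s) P)
    (hΦ : ∀ n, ∀ r ∈ (Φ n).support, r ∈ Icc 0 u) :
    ∃ z : (Icc 0 u → ℝ) → ℝ, Measurable z ∧ Z =ᵐ[P] fun ω => z fun s => X s ω := by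
  classical
  let w : ℕ → (Icc 0 u → ℝ) → ℝ := fun n p =>
    ∑ r ∈ (Φ n).support, Φ n r * if h : r ∈ Icc 0 u then p ⟨r, h⟩ else 0
  have hw : ∀ n, Measurable (w n) := by
    refine fun n => Finset.measurable_fun_sum _ fun r _ => measurable_const.mul ?_
    by_cases h : r ∈ Icc 0 u
    · simpa only [dif_pos h] using measurable_pi_apply (⟨r, h⟩ : Icc 0 u)
    · simp only [dif_neg h, measurable_const]
  have hwX : ∀ n ω, stepIntegral X (Φ n) ω = w n fun s => X s ω := fun n ω =>
    Finset.sum_congr rfl fun r hr => by rw [dif_pos (hΦ n r hr)]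
  have hm : ∀ n, AEStronglyMeasurable (stepIntegral X (Φ n)) P := fun n =>
    Finset.aestronglyMeasurable_fun_sum _ fun r hr => (hX r (hΦ n r hr)).const_mul _
  obtain ⟨ns, -, hns⟩ := (tendstoInMeasure_of_tendsto_eLpNorm two_ne_zero hm hZ.memLp.1
    hZ.tendsto).exists_seq_tendsto_ae
  refine ⟨fun p => limsup (fun n => w (ns n) p) atTop, .limsup fun n => hw (ns n), ?_⟩
  filter_upwards [hns] with ω hω
  simp only [hwX] at hω
  exact hω.limsup_eq.symm

/-- With `Ψ = Ψ(t,·|u)`, the variable `X_t - X_u + ∫ Ψ dX` is the Wiener integral corresponding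
to `1_{(u,T]} K(t,·)` under the isometry `X_r ↦ K(r,·)`. It is therefore orthogonal to `X_s`,
`s ≤ u`, hence independent of the past, and Gaussian with variance `∫_u^t K(t,v)² dm(v)`, which is
`ρ̂²(t|u)`. The version stated here has `∫ Ψ dX` replaced by a function `z` of the path up to
time `u`. -/
theorem IsRIGV.exists_innovation (hX : IsRIGV P T X m K) {u t : ℝ} (hu : 0 ≤ u) (hut : u ≤ t)
    (htT : t ≤ T) {Ψ : ℕ → ℝ →₀ ℝ} (hΨ : IsPsi T m K t u Ψ) {Z : Ω → ℝ}
    (hZ : IsWienerIntegral P X Ψ Z) :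
    ∃ z : (Icc 0 u → ℝ) → ℝ, Measurable z ∧ (Z =ᵐ[P] fun ω => z fun s => X s ω) ∧
      IndepFun (fun ω (s : Icc 0 u) => X s ω)
        (fun ω => X t ω - X u ω + z fun s => X s ω) P ∧
      P.map (fun ω => X t ω - X u ω + z fun s => X s ω)
        = gaussianReal 0 (rhoHat P X m K t u ^ 2).toNNReal := by
  have := hX.isGaussianProcess_truncLp.isProbabilityMeasure
  have huT : u ∈ Icc 0 T := ⟨hu, hut.trans htT⟩
  have ht : t ∈ Icc 0 T := ⟨hu.trans hut, htT⟩
  have hsub : Icc 0 u ⊆ Icc 0 T := Icc_subset_Icc_right huT.2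
  have hg := hX.memLp_psi huT ht
  obtain ⟨hsupp, hk⟩ := (hX.regular.isKStarInverse_iff huT hg).1 hΨ
  have hx := (tendsto_linearCombination_truncLp_iff (fun r hr => hX.memLp_two hr)
    (fun n r hr => hsub (hsupp n r hr)) (fun n => EventuallyEq.rfl) hZ.memLp).2 hZ.tendsto
  obtain ⟨z, hz, hZz⟩ := hZ.exists_measurable_comp (fun s hs => (hX.memLp_two (hsub hs)).1) hsupp
  refine ⟨z, hz, hZz, ?_⟩
  set ξ := truncLp P (Icc 0 T) X
  set k := truncLp (dm T m) (Icc 0 T) K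
  set η : Lp ℝ 2 P := ξ t - ξ u + hZ.memLp.toLp Z
  set θ : Lp ℝ 2 (dm T m) := k t - k u + hg.toLp _
  have hηlim : Tendsto (fun n => Finsupp.linearCombination ℝ ξ
      (Finsupp.single t 1 - Finsupp.single u 1 + Ψ n)) atTop (𝓝 η) := by
    simpa only [map_add, map_sub, Finsupp.linearCombination_single, one_smul] using
      hx.const_add (ξ t - ξ u)
  have hθlim : Tendsto (fun n => Finsupp.linearCombination ℝ k
      (Finsupp.single t 1 - Finsupp.single u 1 + Ψ n)) atTop (𝓝 θ) := by
    simpa only [map_add, map_sub, Finsupp.linearCombination_single, one_smul] using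
      hk.const_add (k t - k u)
  -- On `[0,u)` the three terms cancel; beyond `u` only `K(t,·)` is left, since `K(u,·)` vanishes.
  have hθae : ⇑θ =ᵐ[dm T m] (Ioi u).indicator (K t) := by
    filter_upwards [Lp.coeFn_add (k t - k u) (hg.toLp _), Lp.coeFn_sub (k t) (k u),
      coeFn_truncLp ht (hX.regular.memLp_section t ht),
      coeFn_truncLp huT (hX.regular.memLp_section u huT), hg.coeFn_toLp,
      ae_mem_Ioc, hX.regular.ae_ne u] with v h1 h2 h3 h4 h5 h6 h7
    rw [h1, Pi.add_apply, h2, Pi.sub_apply, h3, h4, h5]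
    rcases lt_or_gt_of_ne h7 with h | h
    · rw [indicator_of_mem (show v ∈ Ico 0 u from ⟨h6.1.le, h⟩),
        indicator_of_notMem (show v ∉ Ioi u from h.not_gt)]
      ring
    · rw [indicator_of_notMem (show v ∉ Ico 0 u from fun h' => h'.2.not_gt h),
        indicator_of_mem (show v ∈ Ioi u from h),
        hX.regular.volterra u huT v ⟨h6.1.le, h6.2⟩ h]
      ring
  have hinner : ∀ s ∈ Icc 0 u, inner ℝ (ξ s) η = 0 := by
    intro s hs
    have e : inner ℝ (ξ s) η = inner ℝ (k s) θ := by
      refine inner_lim_eq hX.inner_truncLp (Φ := fun _ => Finsupp.single s 1) ?_ ?_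
        hηlim hθlim
      · simp [ξ]
      · simp [k]
    rw [e, L2.inner_def]
    refine integral_eq_zero_of_ae ?_
    filter_upwards [hθae, coeFn_truncLp (hsub hs) (hX.regular.memLp_section s (hsub hs)),
      ae_mem_Ioc] with v h1 h2 h3
    rw [h1, h2]
    by_cases h : v ∈ Ioi u
    · rw [hX.regular.volterra s (hsub hs) v ⟨h3.1.le, h3.2⟩ (hs.2.trans_lt h)]
      simp
    · simp [indicator_of_notMem h]
  have hnorm : ‖η‖ ^ 2 = rhoHat P X m K t u ^ 2 := by
    have e : ‖η‖ ^ 2 = cov P X t t - ∫ v in Ioc 0 u, K t v * K t v ∂m.measure := by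
      have hsq : Integrable (fun v => K t v * K t v) (dm T m) :=
        (hX.regular.memLp_section t ht).integrable_mul (hX.regular.memLp_section t ht)
      rw [← real_inner_self_eq_norm_sq, inner_lim_eq hX.inner_truncLp hηlim hθlim hηlim hθlim,
        hX.cov_eq t ht t ht, hX.regular.integral_mul_eq ht ht, setIntegral_dm huT.2,
        ← integral_add_compl measurableSet_Iic hsq, add_sub_cancel_left, compl_Iic,
        ← integral_indicator measurableSet_Ioi, L2.inner_def]
      refine integral_congr_ae ?_
      filter_upwards [hθae] with v h1
      rw [h1]
      by_cases h : v ∈ Ioi u <;> simp [h, -mem_Ioi, sq]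
    rw [rhoHat, Real.sq_sqrt (e ▸ sq_nonneg _), e]
  have hV := fun ζ (hζ : ζ ∈ (Submodule.span ℝ (range ξ)).topologicalClosure) =>
    map_eq_gaussianReal_of_mem_topologicalClosure
      (fun ζ hζ => hX.map_eq_gaussianReal_of_mem_span hζ) hζ
  have hξmem : ∀ s, ξ s ∈ (Submodule.span ℝ (range ξ)).topologicalClosure := fun s =>
    Submodule.le_topologicalClosure _ (Submodule.subset_span (mem_range_self s))
  have hηmem : η ∈ (Submodule.span ℝ (range ξ)).topologicalClosure :=
    mem_closure_of_tendsto hηlim (.of_forall fun n =>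
      Finsupp.mem_span_range_iff_exists_finsupp.2 ⟨_, rfl⟩)
  have hY : (fun ω => X t ω - X u ω + z fun s => X s ω) =ᵐ[P] η := by
    filter_upwards [Lp.coeFn_add (ξ t - ξ u) (hZ.memLp.toLp Z), Lp.coeFn_sub (ξ t) (ξ u),
      coeFn_truncLp ht (hX.memLp_two ht), coeFn_truncLp huT (hX.memLp_two huT),
      hZ.memLp.coeFn_toLp, hZz] with ω h1 h2 h3 h4 h5 h6
    rw [h1, Pi.add_apply, h2, Pi.sub_apply, h3, h4, h5, h6]
  refine ⟨indepFun_of_inner_eq_zero hV (fun s : Icc 0 u => hξmem s)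
    (fun s => (coeFn_truncLp (hsub s.2) (hX.memLp_two (hsub s.2))).symm) hηmem hY
    fun s => hinner s s.2, ?_⟩
  rw [Measure.map_congr hY, hV η hηmem, ← hnorm, Real.toNNReal_pow (norm_nonneg _),
    norm_toNNReal]

end GaussianVolterra

/-! ### Scaling the standard normal law -/

section StandardNormal

theorem integrable_gaussianReal_iff {h : ℝ → ℝ} (hh : Measurable h) (σ : ℝ) :
    Integrable h (gaussianReal 0 (σ ^ 2).toNNReal) ↔
      Integrable (fun x => h (σ * x) * gaussianPDFReal 0 1 x) volume := by
  have e : gaussianReal 0 (σ ^ 2).toNNReal = (gaussianReal 0 1).map (σ * ·) := by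
    rw [gaussianReal_map_const_mul, mul_zero, mul_one]
    congr 1
    exact Real.toNNReal_of_nonneg _
  rw [e, integrable_map_measure hh.aestronglyMeasurable (by fun_prop),
    gaussianReal_of_var_ne_zero _ one_ne_zero, integrable_withDensity_iff_integrable_smul'
    (measurable_gaussianPDF 0 1) (by simp [gaussianPDF])]
  simp [gaussianPDF, ENNReal.toReal_ofReal (gaussianPDFReal_nonneg _ _ _), mul_comm]

theorem integral_gaussianReal_eq {h : ℝ → ℝ} (hh : Measurable h) (σ : ℝ) :
    ∫ y, h y ∂gaussianReal 0 (σ ^ 2).toNNReal = ∫ x, h (σ * x) * gaussianPDFReal 0 1 x := by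
  have e : gaussianReal 0 (σ ^ 2).toNNReal = (gaussianReal 0 1).map (σ * ·) := by
    rw [gaussianReal_map_const_mul, mul_zero, mul_one]
    congr 1
    exact Real.toNNReal_of_nonneg _
  rw [e, integral_map (by fun_prop) hh.aestronglyMeasurable,
    integral_gaussianReal_eq_integral_smul one_ne_zero]
  simp only [smul_eq_mul, mul_comm]

end StandardNormal

/-! ### Prediction of the price -/

section Prediction

variable {Ω : Type*} [MeasurableSpace Ω] {P : Measure Ω} {T : ℝ}
  {X : ℝ → Ω → ℝ} {m : StieltjesFunction ℝ} {K : ℝ → ℝ → ℝ}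

theorem IsRIGV.measurable_past (hX : IsRIGV P T X m K) {u : ℝ} (huT : u ≤ T) :
    Measurable fun ω (s : Icc 0 u) => X s ω :=
  measurable_pi_lambda _ fun s => hX.measurable s (Icc_subset_Icc_right huT s.2)

/-- `X_t` is the sum of the past-measurable `X_u - ∫ Ψ dX` and of an independent innovation, whose
variance is the conditional variance. -/
theorem IsRIGV.condVar_past [IsProbabilityMeasure P] (hX : IsRIGV P T X m K) {u t : ℝ}
    (hu : 0 ≤ u) (hut : u ≤ t) (htT : t ≤ T) :
    condVar (past X u) (X t) P =ᵐ[P] fun _ => rhoHat P X m K t u ^ 2 := by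
  have huT : u ∈ Icc 0 T := ⟨hu, hut.trans htT⟩
  have ht : t ∈ Icc 0 T := ⟨hu.trans hut, htT⟩
  obtain ⟨Ψ, hΨ⟩ := hX.regular.exists_isKStarInverse hX.invertible huT (hX.memLp_psi huT ht)
  obtain ⟨Z, hZ⟩ := hX.exists_isWienerIntegral huT (hX.memLp_psi huT ht) hΨ
  obtain ⟨z, hz, -, hind, hlaw⟩ := hX.exists_innovation hu hut htT hΨ hZ
  have hU := hX.measurable_past huT.2
  set U : Ω → Icc 0 u → ℝ := fun ω s => X s ω with hUdef
  set Y : Ω → ℝ := fun ω => X t ω - X u ω + z (U ω) with hYdef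
  have hY : Measurable Y := ((hX.measurable t ht).sub (hX.measurable u huT)).add (hz.comp hU)
  have hYgauss : HasGaussianLaw Y P := ⟨by rw [hlaw]; infer_instance⟩
  have hY2 : MemLp Y 2 P := hYgauss.memLp_two
  have hu' : u ∈ Icc 0 u := ⟨hu, le_rfl⟩
  have h1 := (condExp_comap_of_indepFun hU hY.aemeasurable hind
    (h := fun q => q.1 ⟨u, hu'⟩ - z q.1 + q.2) (by fun_prop) (by
      refine ((hX.memLp_two ht).integrable one_le_two).congr (.of_forall fun ω => ?_)
      simp only [hYdef, hUdef]
      ring)).2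
  have hid : Integrable (fun y : ℝ => y) (gaussianReal 0 (rhoHat P X m K t u ^ 2).toNNReal) :=
    (memLp_id_gaussianReal 1).integrable le_rfl
  have hXt : (fun ω => U ω ⟨u, hu'⟩ - z (U ω) + Y ω) = X t := by
    funext ω
    simp only [hYdef, hUdef]
    ring
  simp only [hXt, hlaw] at h1
  have h2 := (condExp_comap_of_indepFun hU hY.aemeasurable hind
    (h := fun q => q.2 ^ 2) (by fun_prop) hY2.integrable_sq).2
  have hsq : ∫ y, y ^ 2 ∂gaussianReal 0 (rhoHat P X m K t u ^ 2).toNNReal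
      = rhoHat P X m K t u ^ 2 := by
    have h3 := variance_id_gaussianReal (μ := 0) (v := (rhoHat P X m K t u ^ 2).toNNReal)
    rw [variance_of_integral_eq_zero aemeasurable_id integral_id_gaussianReal,
      Real.coe_toNNReal _ (sq_nonneg _)] at h3
    exact h3
  simp only [hlaw, hsq] at h2
  rw [past_eq_comap, condVar]
  refine (condExp_congr_ae ?_).trans h2
  filter_upwards [h1] with ω hω
  rw [Pi.pow_apply, Pi.sub_apply, hω, integral_add (integrable_const _) hid,
    integral_id_gaussianReal, integral_const]
  simp only [hYdef, hUdef, probReal_univ, one_smul]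
  ring

theorem IsRIGV.condExp_price [IsProbabilityMeasure P] (hX : IsRIGV P T X m K) {u t : ℝ}
    (hu : 0 ≤ u) (hut : u ≤ t) (htT : t ≤ T) {Ψ : ℕ → ℝ →₀ ℝ} (hΨ : IsPsi T m K t u Ψ) {Z : Ω → ℝ}
    (hZ : IsWienerIntegral P X Ψ Z) (μ : ℝ → ℝ) {S₀ : ℝ} (hS₀ : S₀ ≠ 0) {f : ℝ → ℝ → ℝ}
    (hf : Measurable (f t)) (hfS : Integrable (fun ω => f t (price P T X μ S₀ t ω)) P) :
    (∀ᵐ ω ∂P, Integrable (predictionIntegrand P T X m K μ S₀ f u t Z ω) volume) ∧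
      P[fun ω => f t (price P T X μ S₀ t ω) | past (price P T X μ S₀) u]
        =ᵐ[P] fun ω => ∫ x, predictionIntegrand P T X m K μ S₀ f u t Z ω x := by
  have huT : u ∈ Icc 0 T := ⟨hu, hut.trans htT⟩
  have ht : t ∈ Icc 0 T := ⟨hu.trans hut, htT⟩
  obtain ⟨z, hz, hZz, hind, hlaw⟩ := hX.exists_innovation hu hut htT hΨ hZ
  have hU := hX.measurable_past huT.2
  set U : Ω → Icc 0 u → ℝ := fun ω s => X s ω with hUdef
  set Y : Ω → ℝ := fun ω => X t ω - X u ω + z (U ω) with hYdef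
  have hY : Measurable Y := ((hX.measurable t ht).sub (hX.measurable u huT)).add (hz.comp hU)
  have hu' : u ∈ Icc 0 u := ⟨hu, le_rfl⟩
  -- `S_t` as a function of the path up to time `u` and of the innovation `Y`.
  let h : (Icc 0 u → ℝ) × ℝ → ℝ := fun q =>
    f t (S₀ * Real.exp (beta P T X μ 0 u + q.1 ⟨u, hu'⟩)
      * Real.exp (beta P T X μ u t - z q.1 + q.2))
  have hh : Measurable h := by fun_prop
  have hprice : (fun ω => h (U ω, Y ω)) = fun ω => f t (price P T X μ S₀ t ω) := by
    funext ω
    rw [price_eq_mul_exp μ S₀ u t]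
    simp only [h, price, hYdef, hUdef]
    ring_nf
  have hpred : ∀ ω, Z ω = z (U ω) → predictionIntegrand P T X m K μ S₀ f u t Z ω
      = fun x => h (U ω, rhoHat P X m K t u * x) * gaussianPDFReal 0 1 x := by
    intro ω hω
    funext x
    rw [predictionIntegrand, hω]
    rfl
  obtain ⟨h1, h2⟩ := condExp_comap_of_indepFun hU hY.aemeasurable hind hh (hprice ▸ hfS)
  rw [hprice] at h2
  rw [hlaw] at h1 h2
  rw [past_price μ hS₀, past_eq_comap]
  have hsec : ∀ ω, Measurable fun y => h (U ω, y) := fun ω => hh.comp measurable_prodMk_left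
  constructor
  · filter_upwards [h1, hZz] with ω h3 h4
    rw [hpred ω h4]
    exact (integrable_gaussianReal_iff (hsec ω) _).1 h3
  · filter_upwards [h2, hZz] with ω h3 h4
    rw [h3, hpred ω h4]
    exact integral_gaussianReal_eq (hsec ω) _

end Prediction

end GaussVolterra

theorem corollary4p2 {Ω : Type*} [MeasurableSpace Ω] (P : Measure Ω) [IsProbabilityMeasure P]
    (T : ℝ) (hT : 0 < T)
    (X : ℝ → Ω → ℝ) (m : StieltjesFunction ℝ) (K : ℝ → ℝ → ℝ)
    (hX : GaussVolterra.IsRIGV P T X m K)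
    (μ : ℝ → ℝ) (hμ : ContinuousOn μ (Icc 0 T)) (hμ' : BoundedVariationOn μ (Icc 0 T))
    (S₀ : ℝ) (hS₀ : S₀ ≠ 0)
    (u t : ℝ) (hu : 0 ≤ u) (hut : u ≤ t) (htT : t ≤ T)
    (f : ℝ → ℝ → ℝ) (hf : Measurable (f t))
    (hfS : Integrable (fun ω => f t (GaussVolterra.price P T X μ S₀ t ω)) P) :
    -- `ρ̂²(t|u)` is the conditional variance of `X_t` given `F_u^X`
    condVar (GaussVolterra.past X u) (X t) P
        =ᵐ[P] (fun _ => GaussVolterra.rhoHat P X m K t u ^ 2) ∧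
    -- the integrand `Ψ(t,·|u)` exists
    (∃ Ψ, GaussVolterra.IsPsi T m K t u Ψ) ∧
    ∀ Ψ, GaussVolterra.IsPsi T m K t u Ψ →
      -- the Wiener integral `∫_0^u Ψ(t,s|u) dX_s` exists
      (∃ Z, GaussVolterra.IsWienerIntegral P X Ψ Z) ∧
      ∀ Z, GaussVolterra.IsWienerIntegral P X Ψ Z →
        (∀ᵐ ω ∂P, Integrable
          (GaussVolterra.predictionIntegrand P T X m K μ S₀ f u t Z ω) volume) ∧
        condExp (GaussVolterra.past (GaussVolterra.price P T X μ S₀) u) P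
            (fun ω => f t (GaussVolterra.price P T X μ S₀ t ω))
          =ᵐ[P] fun ω =>
            ∫ z, GaussVolterra.predictionIntegrand P T X m K μ S₀ f u t Z ω z := by
  have huT : u ∈ Icc 0 T := ⟨hu, hut.trans htT⟩
  have hg := hX.memLp_psi huT ⟨hu.trans hut, htT⟩
  exact ⟨hX.condVar_past hu hut htT, hX.regular.exists_isKStarInverse hX.invertible huT hg,
    fun Ψ hΨ => ⟨hX.exists_isWienerIntegral huT hg hΨ,
      fun Z hZ => hX.condExp_price hu hut htT hΨ hZ μ hS₀ hf hfS⟩⟩
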